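/- Let $G=(V,E)$ be a finite digraph, $E\subseteq V\times V$, in which self-loops are allowed, and let $V_R=\{v\in V:(v,v)\in E\}$. Assume that the reflexive part of $G$, i.e. the subgraph induced by $V_R$, is undirected ($(u,v)\in E$ implies $(v,u)\in E$ for $u,v\in V_R$) and chordal (every simple cycle of length at least $4$ has a chord, i.e. two nonconsecutive vertices of the cycle are adjacent). Let $\alpha,\beta\in\mathbb R$ with $0<\beta-\alpha<\pi$. For a square complex matrix $A$ let $W(A)=\{x^*Ax : x^*x=1\}$ and $W'(A)=\{x^*Ax : x\neq 0\}$. Call $A$ semisectorial if $0\notin\operatorname{int}W(A)$, quasisectorial if moreover the closure of $W'(A)$ contains no nontrivial real subspace of $\mathbb C$, and sectorial if moreover $0\notin W(A)$. A semisectorial matrix is $*$-congruent ($A=TBT^*$ with $T$ nonsingular) to a direct sum $B$ of a zero block, blocks $e^{i\alpha_1},\dots,e^{i\alpha_l}$ of size $1$, and $m$ copies of $e^{i\gamma}\begin{bmatrix}1&2\\0&1\end{bmatrix}$; any choice of the values $\alpha_1,\dots,\alpha_l$ (each modulo $2\pi$) together with $m$ copies of $\gamma\pm\frac{\pi}{2}$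 ($\gamma$ modulo $2\pi$) inside an interval of length $\pi$ is called a set of phases of $A$. Let $\mathcal C(\alpha,\beta)$ be the set of sectorial matrices (of any size) having a set of phases contained in the open interval $(\alpha,\beta)$. Let $C$ be a partial complex matrix with pattern $G$: rows and columns are indexed by $V$, and the entry $C_{ij}$ is specified exactly when $(i,j)\in E$. Then the unspecified entries of $C$ can be chosen so that the completed matrix lies in $\mathcal C(\alpha,\beta)$ if and only if, for every clique $K\subseteq V_R$ (a set of vertices any two of which are adjacent), the fully specified principal submatrix $C[K]=(C_{ij})_{i,j\in K}$ lies in $\mathcal C(\alpha,\beta)$. -/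

import Mathlib

open scoped Matrix

noncomputable section

namespace PhaseCompletion

section Graphs

variable {V : Type*}

/-- The set of vertices of a digraph that carry a self-loop. -/
def reflexiveVertices (G : Digraph V) : Set V := {u | G.Adj u u}

/-- The subgraph induced by a set of vertices. -/
def inducedSubgraph (G : Digraph V) (W : Set V) : Digraph W where
  Adj u v := G.Adj u v

/-- The reflexive part: the subgraph induced by the vertices with self-loops. -/
def reflexivePart (G : Digraph V) : Digraph (reflexiveVertices G) :=
  inducedSubgraph G (reflexiveVertices G)

/-- A digraph is undirected if its edge set is symmetric. -/
def IsUndirected (G : Digraph V) : Prop := ∀ u v, G.Adj u v → G.Adj v u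

/-- `v 0, …, v (m - 1), v 0` is a simple cycle of length `m`: the listed vertices are distinct
and cyclically consecutive ones are adjacent. -/
def IsSimpleCycle (G : Digraph V) {m : ℕ} (v : Fin m → V) : Prop :=
  Function.Injective v ∧
    ∀ i j : Fin m, (j : ℕ) = ((i : ℕ) + 1) % m → G.Adj (v i) (v j)

/-- Two nonconsecutive vertices of the cyclic sequence, at positions `i, j` with
`2 ≤ j - i < m - 1`, are adjacent. -/
def HasChord (G : Digraph V) {m : ℕ} (v : Fin m → V) : Prop :=
  ∃ i j : Fin m, (i : ℕ) + 2 ≤ j ∧ (j : ℕ) + 1 < i + m ∧ G.Adj (v i) (v j)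

/-- Chordality of an undirected graph: every simple cycle of length at least `4` has a chord.
(Only used for graphs satisfying `IsUndirected`.) -/
def IsChordal (G : Digraph V) : Prop :=
  ∀ (m : ℕ) (v : Fin m → V), 4 ≤ m → IsSimpleCycle G v → HasChord G v

/-- A clique: a set of vertices whose induced subgraph is complete, self-loops included. -/
def IsClique (G : Digraph V) (K : Finset V) : Prop := ∀ u ∈ K, ∀ v ∈ K, G.Adj u v

end Graphs

section PartialMatrices

variable {V : Type*}

/-- A partial complex matrix with pattern `G`: the entry at `(i, j)` is specified exactly when
`(i, j)` is an edge of `G`. -/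
def PartialMatrix (G : Digraph V) : Type _ := ∀ i j : V, G.Adj i j → ℂ

/-- `A` is a completion of the partial matrix `C`. -/
def IsCompletion {G : Digraph V} (C : PartialMatrix G) (A : Matrix V V ℂ) : Prop :=
  ∀ (i j : V) (h : G.Adj i j), A i j = C i j h

/-- The (fully specified) principal submatrix `C[K]` indexed by a clique `K`. -/
def cliqueSubmatrix {G : Digraph V} (C : PartialMatrix G) (K : Finset V) (hK : IsClique G K) :
    Matrix K K ℂ :=
  Matrix.of fun i j => C i j (hK i i.2 j j.2)

end PartialMatrices

section Phases

variable {ι : Type*} [Fintype ι]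

/-- The numerical range `{x* C x | x* x = 1}`. -/
def numericalRange (C : Matrix ι ι ℂ) : Set ℂ :=
  {z | ∃ x : ι → ℂ, star x ⬝ᵥ x = 1 ∧ star x ⬝ᵥ (C *ᵥ x) = z}

/-- The angular numerical range `{x* C x | x ≠ 0}`. -/
def angularNumericalRange (C : Matrix ι ι ℂ) : Set ℂ :=
  {z | ∃ x : ι → ℂ, x ≠ 0 ∧ star x ⬝ᵥ (C *ᵥ x) = z}

/-- A cone in the plane is pointed if it contains no nontrivial (real) subspace. -/
def IsPointed (S : Set ℂ) : Prop :=
  ∀ L : Submodule ℝ ℂ, (L : Set ℂ) ⊆ S → L = ⊥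

def IsSemisectorial (C : Matrix ι ι ℂ) : Prop := (0 : ℂ) ∉ interior (numericalRange C)

def IsQuasisectorial (C : Matrix ι ι ℂ) : Prop :=
  IsSemisectorial C ∧ IsPointed (closure (angularNumericalRange C))

def IsSectorial (C : Matrix ι ι ℂ) : Prop :=
  IsQuasisectorial C ∧ (0 : ℂ) ∉ numericalRange C

/-- `*`-congruence: `A = T B T*` for some nonsingular `T`. -/
def IsCongruent [DecidableEq ι] (A B : Matrix ι ι ℂ) : Prop :=
  ∃ T : Matrix ι ι ℂ, IsUnit T ∧ A = T * B * Tᴴ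

/-- The congruence canonical form of a semisectorial matrix: the direct sum of the `k × k` zero
matrix, of the `1 × 1` blocks `exp (i a j)` for `j < l`, and of `m` copies of
`exp (i γ) [1 2; 0 1]`. -/
def congruenceCanonicalForm (k l m : ℕ) (a : Fin l → ℝ) (γ : ℝ) :
    Matrix (Fin k ⊕ (Fin l ⊕ (Fin 2 × Fin m))) (Fin k ⊕ (Fin l ⊕ (Fin 2 × Fin m))) ℂ :=
  Matrix.fromBlocks 0 0 0
    (Matrix.fromBlocks
      (Matrix.diagonal fun j => Complex.exp (Complex.I * (a j : ℂ))) 0 0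
      (Matrix.blockDiagonal fun _ : Fin m =>
        Complex.exp (Complex.I * (γ : ℂ)) • !![(1 : ℂ), 2; 0, 1]))

/-- `φ` is a set of phases (with multiplicity) of `C`: `C` is semisectorial, and the members of
`φ` are values, within an interval of length `π`, of the arguments `a j` and of `m` copies of
`γ ± π / 2` in a congruence canonical form of `C`. -/
def IsSetOfPhases [DecidableEq ι] (C : Matrix ι ι ℂ) (φ : Multiset ℝ) : Prop :=
  IsSemisectorial C ∧
  (∃ (k l m : ℕ) (a : Fin l → ℝ) (γ : ℝ) (e : (Fin k ⊕ (Fin l ⊕ (Fin 2 × Fin m))) ≃ ι),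
    IsCongruent C (Matrix.reindex e e (congruenceCanonicalForm k l m a γ)) ∧
    φ = Finset.univ.val.map a + Multiset.replicate m (γ + Real.pi / 2) +
      Multiset.replicate m (γ - Real.pi / 2)) ∧
  ∃ t : ℝ, ∀ x ∈ φ, x ∈ Set.Icc t (t + Real.pi)

/-- The cone of sectorial matrices with phases in the open interval `(α, β)`. Phases are
determined only up to a common multiple of `2π`; membership means that a set of phases can be
chosen inside `(α, β)`. -/
def strictPhaseBoundedCone (ι : Type*) [Fintype ι] [DecidableEq ι] (α β : ℝ) :
    Set (Matrix ι ι ℂ) :=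
  {C | IsSectorial C ∧ ∃ φ : Multiset ℝ, IsSetOfPhases C φ ∧ ∀ x ∈ φ, x ∈ Set.Ioo α β}

end Phases

end PhaseCompletion

end

open scoped Matrix

/-! Since `0 < β - α < π`, the open sector between the angles `α` and `β` is the intersection of two
open half-planes, and `A` lies in the cone exactly when `x* A x` lies in that sector for every `x ≠
0`. Equivalently, the Hermitian matrices `P = Im (e^{-iα} A)` and `Q = Im (-e^{-iβ} A)` are both
positive definite (`mem_strictPhaseBoundedCone_iff_isPosDefOn`). Because `sin (β - α) ≠ 0`, the
correspondence `A ↔ (P, Q)` is a bijection onto pairs of Hermitian matrices, and `A i j` is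
recovered from `P i j` and `Q i j` alone. The problem therefore splits into two independent positive
definite completion problems.

Necessity holds because positive definiteness passes to principal submatrices. For sufficiency, each
Hermitian problem is first solved on the looped vertices, where the pattern is chordal: a simplicial
vertex (Dirac) is removed, the rest is completed, and the vertex is put back by a Schur complement
argument (`exists_isPosDefOn_of_isChordalOn`). At a vertex without a loop the diagonal entry is
free, so a large value there allows any off-diagonal column (`IsPosDefOn.exists_extension`). -/

namespace PhaseCompletion

/-! ### Chordal graphs and simplicial vertices. -/

section Chordal

variable {V : Type*} {R : V → V → Prop} {W : Set V} {s t u : V} {n : ℕ} {p : ℕ → V}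

/-- `p 0, …, p n` is a walk of `R` from `s` to `t` whose inner vertices lie in `W`. -/
structure IsWalkThrough (R : V → V → Prop) (W : Set V) (s t : V) (n : ℕ) (p : ℕ → V) : Prop where
  start : p 0 = s
  finish : p n = t
  step : ∀ i < n, R (p i) (p (i + 1))
  inner : ∀ i, 0 < i → i < n → p i ∈ W

/-- The `j - i - 1` vertices strictly between positions `i` and `j` are skipped; hence a walk of
minimal length has no chords. -/
theorem IsWalkThrough.shortcut (h : IsWalkThrough R W s t n p) {i j : ℕ} (hij : i < j)
    (hj : j ≤ n) (hR : R (p i) (p j)) :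
    IsWalkThrough R W s t (n - (j - i - 1))
      (fun k => if k ≤ i then p k else p (k + (j - i - 1))) := by
  refine ⟨by simp [h.start], ?_, ?_, ?_⟩
  · have h1 : ¬ n - (j - i - 1) ≤ i := by omega
    have h2 : n - (j - i - 1) + (j - i - 1) = n := by omega
    simp only [h1, if_false, h2, h.finish]
  · intro k hk
    by_cases h1 : k + 1 ≤ i
    · have h2 : k ≤ i := by omega
      simp only [h1, h2, if_true]
      exact h.step k (by omega)
    · by_cases h2 : k ≤ i
      · have h3 : k = i := by omega
        subst h3
        have h4 : k + 1 + (j - k - 1) = j := by omega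
        simpa [h4] using hR
      · simp only [h1, h2, if_false]
        have h4 : k + 1 + (j - i - 1) = k + (j - i - 1) + 1 := by omega
        rw [h4]
        exact h.step _ (by omega)
  · intro k h0 hk
    by_cases h2 : k ≤ i
    · simp only [h2, if_true]
      exact h.inner k h0 (by omega)
    · simp only [h2, if_false]
      exact h.inner _ (by omega) (by omega)

theorem IsWalkThrough.extend (h : IsWalkThrough R W s u n p) (hu : 0 < n → u ∈ W)
    (hR : R u t) : IsWalkThrough R W s t (n + 1) (fun k => if k ≤ n then p k else t) := by
  refine ⟨by simp [h.start], by simp, ?_, ?_⟩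
  · intro k hk
    by_cases h1 : k + 1 ≤ n
    · have h2 : k ≤ n := by omega
      simp only [h1, h2, if_true]
      exact h.step k (by omega)
    · have h3 : k = n := by omega
      subst h3
      simpa [h.finish] using hR
  · intro k h0 hk
    have h2 : k ≤ n := by omega
    simp only [h2, if_true]
    rcases h2.lt_or_eq with h3 | h3
    · exact h.inner k h0 h3
    · subst h3
      rw [h.finish]
      exact hu h0

/-- Any two members of `W` are joined by a chain of `R` inside `W`. -/
def IsChainConnected (R : V → V → Prop) (W : Set V) : Prop :=
  ∀ a ∈ W, ∀ b ∈ W, Relation.ReflTransGen (fun x y => R x y ∧ x ∈ W ∧ y ∈ W) a b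

theorem IsChainConnected.exists_walk (hW : IsChainConnected R W) {a b : V} (ha : a ∈ W)
    (hb : b ∈ W) (hs : R s a) (ht : R b t) : ∃ n p, IsWalkThrough R W s t n p := by
  have key : ∃ n p, IsWalkThrough R W s b n p := by
    have hab := hW a ha b hb
    clear ht hb
    induction hab with
    | refl =>
      have h0 : IsWalkThrough R W s s 0 (fun _ => s) :=
        ⟨rfl, rfl, fun i hi => absurd hi (by omega), fun i _ hi => absurd hi (by omega)⟩
      exact ⟨_, _, h0.extend (fun h => absurd h (by omega)) hs⟩
    | tail _ hbc ih =>
      obtain ⟨n, p, hp⟩ := ih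
      exact ⟨_, _, hp.extend (fun _ => hbc.2.1) hbc.1⟩
  obtain ⟨n, p, hp⟩ := key
  exact ⟨_, _, hp.extend (fun _ => hb) ht⟩

theorem IsChainConnected.insert_of_rel (hsymm : ∀ x y, R x y → R y x)
    (hW : IsChainConnected R W) {w : V} (hw : w ∈ W) (hs : R s w) :
    IsChainConnected R (insert s W) := by
  have mono : ∀ a ∈ W, ∀ b ∈ W, Relation.ReflTransGen
      (fun x y => R x y ∧ x ∈ insert s W ∧ y ∈ insert s W) a b := fun a ha b hb =>
    Relation.ReflTransGen.mono (fun x y h => ⟨h.1, Or.inr h.2.1, Or.inr h.2.2⟩) _ _ (hW a ha b hb)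
  rintro a (rfl | ha) b (rfl | hb)
  · exact .refl
  · exact .head ⟨hs, Or.inl rfl, Or.inr hw⟩ (mono w hw b hb)
  · exact .tail (mono a ha w hw) ⟨hsymm _ _ hs, Or.inr hw, Or.inl rfl⟩
  · exact mono a ha b hb

/-- Every simple cycle of `R` of length at least `4` with vertices in `T` has a chord. -/
def IsChordalOn (R : V → V → Prop) (T : Set V) : Prop :=
  ∀ (m : ℕ) (v : Fin m → V), 4 ≤ m → (∀ i, v i ∈ T) → Function.Injective v →
    (∀ i j : Fin m, (j : ℕ) = ((i : ℕ) + 1) % m → R (v i) (v j)) →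
    ∃ i j : Fin m, (i : ℕ) + 2 ≤ j ∧ (j : ℕ) + 1 < i + m ∧ R (v i) (v j)

theorem IsChordalOn.mono {S T : Set V} (h : IsChordalOn R T) (hST : S ⊆ T) : IsChordalOn R S :=
  fun m v hm hv => h m v hm fun i => hST (hv i)

/-- Two vertices joined by a walk through `W` and by a vertex `b` far from `W` are adjacent. -/
theorem IsChordalOn.rel_of_walk {T : Set V} (hT : IsChordalOn R T) (hsymm : ∀ x y, R x y → R y x)
    {b : V} (hst : s ≠ t) (hs : s ∈ T) (ht : t ∈ T) (hb : b ∈ T) (hWT : W ⊆ T)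
    (htW : t ∉ W) (hbW : ∀ w ∈ W, ¬ R w b) (hbnW : b ∉ W) (hsb : R s b) (htb : R t b)
    (hbs : b ≠ s) (hbt : b ≠ t)
    (hex : ∃ n p, IsWalkThrough R W s t n p) : R s t := by
  classical
  by_contra hnot
  -- A shortest walk from `s` to `t` is an induced path. Closing it up through `b` will give a
  -- chordless cycle of length at least `4`.
  obtain ⟨p, hp⟩ := Nat.find_spec hex
  have hmin : ∀ m, m < Nat.find hex → ¬ ∃ p, IsWalkThrough R W s t m p :=
    fun m hm => Nat.find_min hex hm
  generalize Nat.find hex = n at hp hmin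
  have hnochord : ∀ i j, i + 1 < j → j ≤ n → ¬ R (p i) (p j) := fun i j hij hj hR =>
    hmin _ (by omega) ⟨_, hp.shortcut (by omega) hj hR⟩
  have hn0 : n ≠ 0 := by
    rintro rfl
    exact hst (hp.start.symm.trans hp.finish)
  have hn1 : n ≠ 1 := by
    rintro rfl
    have := hp.step 0 (by omega)
    rw [hp.start, hp.finish] at this
    exact hnot this
  -- A repetition `p i = p j` with `j < n` would make the step out of `p j` a chord from `i` to `j +
  -- 1`.
  have hinj : ∀ i j, i < j → j ≤ n → p i ≠ p j := by
    intro i j hij hj he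
    rcases hj.lt_or_eq with h | rfl
    · have := hp.step j h
      rw [← he] at this
      exact hnochord i (j + 1) (by omega) h this
    · rw [hp.finish] at he
      rcases Nat.eq_zero_or_pos i with rfl | h0
      · exact hst (hp.start.symm.trans he)
      · exact htW (he ▸ hp.inner i h0 hij)
  have hcases : ∀ i ≤ n, p i = s ∧ i = 0 ∨ p i = t ∧ i = n ∨ p i ∈ W := by
    intro i hi
    rcases Nat.eq_zero_or_pos i with rfl | h0
    · exact Or.inl ⟨hp.start, rfl⟩
    · rcases hi.lt_or_eq with h | rfl
      · exact Or.inr (Or.inr (hp.inner i h0 h))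
      · exact Or.inr (Or.inl ⟨hp.finish, rfl⟩)
  have hpb : ∀ i ≤ n, p i ≠ b := by
    intro i hi he
    rcases hcases i hi with h | h | h
    · exact hbs (he.symm.trans h.1)
    · exact hbt (he.symm.trans h.1)
    · exact hbnW (he ▸ h)
  have hpT : ∀ i ≤ n, p i ∈ T := by
    intro i hi
    rcases hcases i hi with h | h | h
    · rw [h.1]; exact hs
    · rw [h.1]; exact ht
    · exact hWT h
  -- The cycle is `p 0, …, p n, b`, with `b` at position `n + 1`. A chord ending at `b` must start
  -- at an inner vertex of the walk, which lies in `W` and so is not adjacent to `b`.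
  obtain ⟨i, j, hij, hji, hR⟩ := hT (n + 2) (fun k => if (k : ℕ) ≤ n then p k else b) (by omega)
    (by
      intro k
      by_cases hk : (k : ℕ) ≤ n
      · simp only [hk, if_true]; exact hpT k hk
      · simp only [hk, if_false]; exact hb)
    (by
      intro k l hkl
      have hk := k.2
      have hl := l.2
      by_cases h1 : (k : ℕ) ≤ n <;> by_cases h2 : (l : ℕ) ≤ n <;>
        simp only [h1, h2, if_true, if_false] at hkl
      · rcases lt_trichotomy (k : ℕ) l with h | h | h
        · exact absurd hkl (hinj _ _ h h2)
        · exact Fin.ext h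
        · exact absurd hkl.symm (hinj _ _ h h1)
      · exact absurd hkl (hpb _ h1)
      · exact absurd hkl.symm (hpb _ h2)
      · exact Fin.ext (by omega))
    (by
      intro k l hkl
      have hk := k.2
      have hl := l.2
      rcases lt_or_ge ((k : ℕ) + 1) (n + 2) with h | h
      · rw [Nat.mod_eq_of_lt h] at hkl
        have h1 : (k : ℕ) ≤ n := by omega
        rcases h1.lt_or_eq with h2 | h2
        · have h3 : (l : ℕ) ≤ n := by omega
          rw [if_pos h1, if_pos h3, hkl]
          exact hp.step _ h2
        · have h3 : ¬ (l : ℕ) ≤ n := by omega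
          rw [if_pos h1, if_neg h3, h2, hp.finish]
          exact htb
      · have h1 : (k : ℕ) + 1 = n + 2 := by omega
        rw [h1, Nat.mod_self] at hkl
        have h2 : ¬ (k : ℕ) ≤ n := by omega
        simp only [h2, hkl, Nat.zero_le, if_true, if_false, hp.start]
        exact hsymm _ _ hsb)
  have hi := i.2
  have hj := j.2
  have h1 : (i : ℕ) ≤ n := by omega
  by_cases h2 : (j : ℕ) ≤ n
  · simp only [h1, h2, if_true] at hR
    exact hnochord _ _ (by omega) h2 hR
  · simp only [h1, h2, if_true, if_false] at hR
    exact hbW _ (hp.inner i (by omega) (by omega)) hR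

/-- **Dirac's theorem**: a nonempty chordal graph has a simplicial vertex. -/
theorem IsChordalOn.exists_simplicial [DecidableEq V] (hsymm : ∀ x y, R x y → R y x)
    (T : Finset V) (hne : T.Nonempty) (hT : IsChordalOn R (T : Set V)) (hrefl : ∀ x ∈ T, R x x) :
    ∃ v ∈ T, ∀ a ∈ T, ∀ b ∈ T, R v a → R v b → R a b := by
  classical
  induction T using Finset.strongInduction with
  | H T ih =>
  -- The candidates are connected sets that miss the neighbourhood of some vertex. One of maximal
  -- size is used, and the induction runs on the set `B` of vertices far from it.
  let F : Finset (Finset V) := T.powerset.filter fun W =>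
    W.Nonempty ∧ IsChainConnected R (W : Set V) ∧ ∃ b ∈ T, ∀ w ∈ W, ¬ R w b
  by_cases hF : F.Nonempty
  · obtain ⟨W, hWF, hmax⟩ := F.exists_max_image Finset.card hF
    simp only [F, Finset.mem_filter, Finset.mem_powerset] at hWF hmax
    obtain ⟨hWT, ⟨w₀, hw₀⟩, hconn, hfar⟩ := hWF
    set B := T.filter fun b => ∀ w ∈ W, ¬ R w b with hB
    have hBT : B ⊂ T := by
      refine Finset.filter_ssubset.2 ⟨w₀, hWT hw₀, fun h => h w₀ hw₀ (hrefl _ (hWT hw₀))⟩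
    have hBne : B.Nonempty := by
      obtain ⟨b, hb, hbW⟩ := hfar
      exact ⟨b, Finset.mem_filter.2 ⟨hb, hbW⟩⟩
    obtain ⟨v, hvB, hv⟩ := ih B hBT hBne (hT.mono (by exact_mod_cast hBT.1))
      fun x hx => hrefl x (hBT.1 hx)
    have hfarB : ∀ b ∈ B, ∀ w ∈ W, ¬ R w b := fun b hb => (Finset.mem_filter.1 hb).2
    have hdisj : ∀ b ∈ B, b ∉ W := fun b hb hbW =>
      hfarB b hb b hbW (hrefl b (hBT.1 hb))
    -- a vertex outside `B` adjacent to some vertex of `B` is adjacent to `W` and to all of `B`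
    have hsep : ∀ x ∈ T, x ∉ B → (∃ b ∈ B, R x b) →
        x ∉ W ∧ (∃ w ∈ W, R x w) ∧ ∀ b ∈ B, R x b := by
      rintro x hx hxB ⟨b₀, hb₀, hxb₀⟩
      have hxW : x ∉ W := fun h => hfarB b₀ hb₀ x h hxb₀
      have hadj : ∃ w ∈ W, R x w := by
        by_contra hno
        push Not at hno
        exact hxB (Finset.mem_filter.2 ⟨hx, fun w hw h => hno w hw (hsymm _ _ h)⟩)
      refine ⟨hxW, hadj, fun b hb => ?_⟩
      by_contra hxb
      obtain ⟨w, hw, hxw⟩ := hadj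
      -- If `x` missed some `b` in `B`, then `W ∪ {x}` would be a larger connected set still far
      -- from `b`.
      have := hmax (insert x W) ⟨Finset.insert_subset hx hWT, Finset.insert_nonempty _ _, by
        rw [Finset.coe_insert]
        exact hconn.insert_of_rel hsymm (Finset.mem_coe.2 hw) hxw, b, hBT.1 hb, by
        intro y hy
        rcases Finset.mem_insert.1 hy with rfl | hy
        · exact hxb
        · exact hfarB b hb y hy⟩
      rw [Finset.card_insert_of_notMem hxW] at this
      omega
    refine ⟨v, hBT.1 hvB, fun a ha b hb hva hvb => ?_⟩
    by_cases haB : a ∈ B <;> by_cases hbB : b ∈ B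
    · exact hv a haB b hbB hva hvb
    · exact hsymm _ _ ((hsep b hb hbB ⟨v, hvB, hsymm _ _ hvb⟩).2.2 a haB)
    · exact (hsep a ha haB ⟨v, hvB, hsymm _ _ hva⟩).2.2 b hbB
    -- Both neighbours of `v` separate it from `W`: they are joined through `W` on one side and
    -- through `v` on the other, so chordality forces them to be adjacent.
    · obtain ⟨haW, ⟨w, hw, haw⟩, -⟩ := hsep a ha haB ⟨v, hvB, hsymm _ _ hva⟩
      obtain ⟨hbW, ⟨w', hw', hbw'⟩, -⟩ := hsep b hb hbB ⟨v, hvB, hsymm _ _ hvb⟩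
      rcases eq_or_ne a b with rfl | hab
      · exact hrefl a ha
      · exact hT.rel_of_walk (W := (W : Set V)) hsymm hab ha hb (hBT.1 hvB) (by exact_mod_cast hWT)
          hbW (hfarB v hvB) (hdisj v hvB) (hsymm _ _ hva) (hsymm _ _ hvb)
          (fun h => haB (h ▸ hvB)) (fun h => hbB (h ▸ hvB))
          (hconn.exists_walk hw hw' haw (hsymm _ _ hbw'))
  -- With no candidate the graph is complete, since a nonadjacent pair `a`, `b` would make `{a}` a
  -- candidate; every vertex is then simplicial.
  · obtain ⟨v, hv⟩ := hne
    refine ⟨v, hv, fun a ha b hb _ _ => ?_⟩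
    by_contra hab
    refine hF ⟨{a}, ?_⟩
    simp only [F, Finset.mem_filter, Finset.mem_powerset]
    refine ⟨by simpa using ha, Finset.singleton_nonempty a, ?_, b, hb, by simpa using hab⟩
    intro x hx y hy
    simp only [Finset.coe_singleton, Set.mem_singleton_iff] at hx hy
    subst hx hy
    exact .refl

end Chordal

/-! ### Positive definite completion of Hermitian matrices. -/

section HermitianCompletion

variable {V : Type*} [Fintype V] {T N : Finset V} {A H : Matrix V V ℂ} {v : V} {x y z : V → ℂ}

/-- The real part of `x* A x` is positive for the nonzero vectors `x` supported in `T`. -/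
def IsPosDefOn (T : Finset V) (A : Matrix V V ℂ) : Prop :=
  ∀ x : V → ℂ, (∀ i ∉ T, x i = 0) → x ≠ 0 → 0 < (star x ⬝ᵥ (A *ᵥ x)).re

theorem IsPosDefOn.mono (h : IsPosDefOn T A) (hN : N ⊆ T) : IsPosDefOn N A :=
  fun x hx => h x fun i hi => hx i fun h' => hi (hN h')

theorem star_dotProduct_eq_of_supported (hx : ∀ i ∉ T, x i = 0) (h : ∀ i ∈ T, y i = z i) :
    star x ⬝ᵥ y = star x ⬝ᵥ z := by
  refine Finset.sum_congr rfl fun i _ => ?_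
  by_cases hi : i ∈ T
  · rw [h i hi]
  · simp [hx i hi]

theorem star_dotProduct_eq_zero_of_supported (hx : ∀ i ∉ T, x i = 0) (h : ∀ i ∈ T, y i = 0) :
    star x ⬝ᵥ y = 0 := by
  rw [star_dotProduct_eq_of_supported hx (z := 0) h, dotProduct_zero]

theorem mulVec_eq_of_supported (hx : ∀ i ∉ T, x i = 0) (i : V) (h : ∀ j ∈ T, A i j = H i j) :
    (A *ᵥ x) i = (H *ᵥ x) i := by
  refine Finset.sum_congr rfl fun j _ => ?_
  by_cases hj : j ∈ T
  · simp only [h j hj]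
  · simp [hx j hj]

theorem quadratic_eq_of_supported (hx : ∀ i ∉ T, x i = 0) (h : ∀ i ∈ T, ∀ j ∈ T, A i j = H i j) :
    star x ⬝ᵥ (A *ᵥ x) = star x ⬝ᵥ (H *ᵥ x) :=
  star_dotProduct_eq_of_supported hx fun i hi => mulVec_eq_of_supported hx i (h i hi)

theorem IsPosDefOn.congr (hA : IsPosDefOn T A) (h : ∀ i ∈ T, ∀ j ∈ T, H i j = A i j) :
    IsPosDefOn T H := fun x hx h0 => by
  rw [quadratic_eq_of_supported hx h]
  exact hA x hx h0

theorem _root_.Matrix.IsHermitian.star_dotProduct_mulVec (hA : A.IsHermitian) (x y : V → ℂ) :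
    star x ⬝ᵥ (A *ᵥ y) = star (star y ⬝ᵥ (A *ᵥ x)) := by
  rw [Matrix.star_dotProduct, Matrix.star_mulVec, hA.eq, Matrix.dotProduct_mulVec]

/-- The principal block on `T` is invertible because a kernel vector would annihilate the form. The
map `L` pads this block with the identity off `T`, so that injectivity on `V → ℂ` gives
surjectivity. -/
theorem IsPosDefOn.exists_mulVec_eq [DecidableEq V] (hA : IsPosDefOn T A) (b : V → ℂ) :
    ∃ y : V → ℂ, (∀ i ∉ T, y i = 0) ∧ ∀ i ∈ T, (A *ᵥ y) i = b i := by
  let L : (V → ℂ) →ₗ[ℂ] (V → ℂ) :=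
    LinearMap.pi fun i => if i ∈ T then LinearMap.proj i ∘ₗ A.mulVecLin else LinearMap.proj i
  have hL : ∀ x i, L x i = if i ∈ T then (A *ᵥ x) i else x i := by
    intro x i
    by_cases hi : i ∈ T <;> simp [L, hi]
  have hinj : Function.Injective L := by
    rw [← LinearMap.ker_eq_bot, LinearMap.ker_eq_bot']
    intro x hx
    by_contra h0
    have hsupp : ∀ i ∉ T, x i = 0 := fun i hi => by
      have := hL x i
      rw [hx, if_neg hi] at this
      exact this.symm
    have hpos := hA x hsupp h0
    rw [star_dotProduct_eq_zero_of_supported hsupp] at hpos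
    · simp at hpos
    · intro i hi
      have := hL x i
      rw [hx, if_pos hi] at this
      exact this.symm
  obtain ⟨y, hy⟩ := LinearMap.injective_iff_surjective.1 hinj fun i => if i ∈ T then b i else 0
  refine ⟨y, fun i hi => ?_, fun i hi => ?_⟩
  · have := hL y i
    simpa [hy, hi, eq_comm] using this
  · have := hL y i
    simpa [hy, hi, eq_comm] using this

theorem mulVec_single_sub_eq_zero [DecidableEq V] (hAv : ∀ i ∈ N, A i v = (A *ᵥ y) i) :
    ∀ i ∈ N, (A *ᵥ (Pi.single v 1 - y)) i = 0 := fun i hi => by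
  simp [Matrix.mulVec_sub, hAv i hi]

/-- The right-hand side is the Schur complement of the block on `N` in the block on `N ∪ {v}`,
realised as the value of the form at `e_v - y`, a vector that `A` makes orthogonal to `N`. -/
theorem quadratic_single_sub_re [DecidableEq V] (hA : A.IsHermitian) (hy : ∀ i ∉ N, y i = 0)
    (hAv : ∀ i ∈ N, A i v = (A *ᵥ y) i) :
    (star (Pi.single v 1 - y) ⬝ᵥ (A *ᵥ (Pi.single v 1 - y))).re =
      (A v v).re - (star y ⬝ᵥ (A *ᵥ y)).re := by
  have h1 : star y ⬝ᵥ (A *ᵥ (Pi.single v 1 - y)) = 0 :=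
    star_dotProduct_eq_zero_of_supported hy (mulVec_single_sub_eq_zero hAv)
  have h2 : star (Pi.single v 1 : V → ℂ) ⬝ᵥ (A *ᵥ y) = star (star y ⬝ᵥ (A *ᵥ y)) := by
    rw [hA.star_dotProduct_mulVec]
    congr 1
    refine star_dotProduct_eq_of_supported hy fun i hi => ?_
    simp [hAv i hi]
  rw [star_sub, sub_dotProduct, h1, sub_zero, Matrix.mulVec_sub, dotProduct_sub, h2]
  simp

/-- Every `x` supported in `T ∪ {v}` is `z + x v • w` with `z` supported in `T`. The cross terms
vanish, so the form is a sum of two nonnegative terms, not both zero. -/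
theorem IsPosDefOn.insert_of_orthogonal [DecidableEq V] (hA : A.IsHermitian)
    (hT : IsPosDefOn T A) {w : V → ℂ} (hv : v ∉ T) (hwv : w v = 1) (hw : ∀ i ∉ insert v T, w i = 0)
    (horth : ∀ i ∈ T, (A *ᵥ w) i = 0) (hpos : 0 < (star w ⬝ᵥ (A *ᵥ w)).re) :
    IsPosDefOn (insert v T) A := by
  intro x hx hx0
  obtain ⟨z, hz⟩ : ∃ z, z = x - x v • w := ⟨_, rfl⟩
  have hxz : x = z + x v • w := by rw [hz]; simp
  have hzT : ∀ i ∉ T, z i = 0 := by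
    intro i hi
    by_cases hiv : i = v
    · subst hiv; simp [hz, hwv]
    · have : i ∉ insert v T := by simp [hiv, hi]
      simp [hz, hw i this, hx i this]
  have h1 : star z ⬝ᵥ (A *ᵥ w) = 0 := star_dotProduct_eq_zero_of_supported hzT horth
  have h2 : star w ⬝ᵥ (A *ᵥ z) = 0 := by rw [hA.star_dotProduct_mulVec, h1, star_zero]
  have hq : star x ⬝ᵥ (A *ᵥ x) =
      star z ⬝ᵥ (A *ᵥ z) + (Complex.normSq (x v) : ℂ) * (star w ⬝ᵥ (A *ᵥ w)) := by
    generalize x v = s at hxz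
    rw [hxz]
    simp only [Matrix.mulVec_add, Matrix.mulVec_smul, star_add, star_smul, add_dotProduct,
      dotProduct_add, smul_dotProduct, dotProduct_smul, h1, h2, smul_eq_mul]
    rw [Complex.normSq_eq_conj_mul_self]
    simp only [RCLike.star_def]
    ring
  rw [hq, Complex.add_re, Complex.re_ofReal_mul]
  by_cases hs : x v = 0
  · have hzx : z = x := by rw [hz, hs]; simp
    have := hT z hzT (hzx ▸ hx0)
    simpa [hs] using this
  · have h3 : 0 < Complex.normSq (x v) * (star w ⬝ᵥ (A *ᵥ w)).re :=
      mul_pos (Complex.normSq_pos.2 hs) hpos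
    by_cases hz0 : z = 0
    · simpa [hz0] using h3
    · linarith [hT z hzT hz0]

/-- Bordering a positive definite matrix by the column `H y` and a large diagonal entry `d`. -/
theorem IsPosDefOn.exists_border [DecidableEq V] (hH : H.IsHermitian) (hT : IsPosDefOn T H)
    (hv : v ∉ T) (hy : ∀ i ∉ T, y i = 0) {d : ℝ} (hd : (star y ⬝ᵥ (H *ᵥ y)).re < d) :
    ∃ A : Matrix V V ℂ, A.IsHermitian ∧ IsPosDefOn (insert v T) A ∧
      (∀ i ∈ T, ∀ j ∈ T, A i j = H i j) ∧ (∀ i ∈ T, A i v = (H *ᵥ y) i) ∧ A v v = d := by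
  let A : Matrix V V ℂ := Matrix.of fun i j =>
    if i = v then (if j = v then (d : ℂ) else star ((H *ᵥ y) j))
    else if j = v then (H *ᵥ y) i else H i j
  have hne : ∀ i ∈ T, i ≠ v := fun i hi h => hv (h ▸ hi)
  have hA : A.IsHermitian := by
    ext i j
    by_cases hi : i = v <;> by_cases hj : j = v <;> simp [A, hi, hj]
    exact hH.apply i j
  have hAT : ∀ i ∈ T, ∀ j ∈ T, A i j = H i j := fun i hi j hj => by
    simp [A, hne i hi, hne j hj]
  have hAv : ∀ i ∈ T, A i v = (H *ᵥ y) i := fun i hi => by simp [A, hne i hi]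
  have hAvv : A v v = d := by simp [A]
  have hAv' : ∀ i ∈ T, A i v = (A *ᵥ y) i := fun i hi => by
    rw [hAv i hi, mulVec_eq_of_supported hy i (hAT i hi)]
  refine ⟨A, hA, ?_, hAT, hAv, hAvv⟩
  refine IsPosDefOn.insert_of_orthogonal hA (hT.congr hAT) hv (w := Pi.single v 1 - y)
    (by simp [hy v hv]) ?_ (mulVec_single_sub_eq_zero hAv') ?_
  · intro i hi
    rw [Finset.mem_insert, not_or] at hi
    simp [hi.1, hy i hi.2]
  · rw [quadratic_single_sub_re hA hy hAv', hAvv, quadratic_eq_of_supported hy hAT]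
    simpa using hd

/-- A partial Hermitian matrix with a chordal pattern all of whose specified principal submatrices
are positive definite has a positive definite completion. -/
theorem exists_isPosDefOn_of_isChordalOn [DecidableEq V] {R : V → V → Prop}
    (hsymm : ∀ i j, R i j → R j i) (hH : H.IsHermitian) (T : Finset V)
    (hchord : IsChordalOn R (T : Set V)) (hrefl : ∀ i ∈ T, R i i)
    (hcl : ∀ K ⊆ T, (∀ i ∈ K, ∀ j ∈ K, R i j) → IsPosDefOn K H) :
    ∃ A : Matrix V V ℂ, A.IsHermitian ∧ IsPosDefOn T A ∧
      ∀ i ∈ T, ∀ j ∈ T, R i j → A i j = H i j := by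
  classical
  induction T using Finset.strongInduction with
  | H T ih =>
  rcases T.eq_empty_or_nonempty with rfl | hne
  · refine ⟨H, hH, fun x hx h0 => absurd (funext fun i => hx i (by simp)) h0, by simp⟩
  obtain ⟨v, hv, hsimp⟩ := hchord.exists_simplicial hsymm T hne hrefl
  have hsub : T.erase v ⊆ T := Finset.erase_subset _ _
  obtain ⟨A, hA, hApos, hAH⟩ := ih (T.erase v) (Finset.erase_ssubset hv)
    (hchord.mono (by exact_mod_cast hsub)) (fun i hi => hrefl i (hsub hi))
    fun K hK => hcl K (hK.trans hsub)
  set N := (T.erase v).filter (R v) with hN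
  have hNT : ∀ i ∈ N, i ∈ T ∧ R v i := fun i hi =>
    ⟨hsub (Finset.mem_filter.1 hi).1, (Finset.mem_filter.1 hi).2⟩
  have hvN : v ∉ N := by simp [hN]
  have hAN : ∀ i ∈ N, ∀ j ∈ N, H i j = A i j := fun i hi j hj =>
    (hAH i (Finset.mem_filter.1 hi).1 j (Finset.mem_filter.1 hj).1
      (hsimp i (hNT i hi).1 j (hNT j hj).1 (hNT i hi).2 (hNT j hj).2)).symm
  -- The new column will be `A y` with `y` supported on the neighbours `N`: it has the prescribed
  -- entries on `N`, and its other entries are free.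
  obtain ⟨y, hy, hAy⟩ := (hApos.mono (Finset.filter_subset _ _ : N ⊆ _)).exists_mulVec_eq
    fun i => H i v
  have hK : IsPosDefOn (insert v N) H := by
    refine hcl _ (Finset.insert_subset hv fun i hi => (hNT i hi).1) ?_
    intro i hi j hj
    have key : ∀ k ∈ insert v N, k ∈ T ∧ R v k := by
      intro k hk
      rcases Finset.mem_insert.1 hk with rfl | hk
      · exact ⟨hv, hrefl _ hv⟩
      · exact hNT k hk
    exact hsimp i (key i hi).1 j (key j hj).1 (key i hi).2 (key j hj).2
  have hHv : ∀ i ∈ N, H i v = (H *ᵥ y) i := fun i hi => by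
    rw [← hAy i hi, mulVec_eq_of_supported hy i (hAN i hi)]
  -- Simpliciality makes `N ∪ {v}` a clique, so its Schur complement `H v v - y* H y` is positive;
  -- `A` and `H` agree on `N`, so the same number governs the bordering of all of `A`.
  have hd : (star y ⬝ᵥ (A *ᵥ y)).re < (H v v).re := by
    have := hK (Pi.single v 1 - y) (by
      intro i hi
      rw [Finset.mem_insert, not_or] at hi
      simp [hi.1, hy i hi.2]) (by
      intro h
      have := congrFun h v
      simp [hy v hvN] at this)
    rw [quadratic_single_sub_re hH hy hHv, quadratic_eq_of_supported hy hAN] at this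
    linarith
  have hyT : ∀ i ∉ T.erase v, y i = 0 := fun i hi =>
    hy i fun h => hi (Finset.mem_filter.1 h).1
  obtain ⟨B, hB, hBpos, hBA, hBv, hBvv⟩ := hApos.exists_border hA (Finset.notMem_erase v T) hyT hd
  rw [Finset.insert_erase hv] at hBpos
  have hcol : ∀ i ∈ T, R v i → B i v = H i v := by
    intro i hi hvi
    by_cases hiv : i = v
    · subst hiv
      rw [hBvv]
      exact Complex.conj_eq_iff_re.1 (hH.apply i i)
    · have hiT := Finset.mem_erase.2 ⟨hiv, hi⟩
      rw [hBv i hiT, hAy i (Finset.mem_filter.2 ⟨hiT, hvi⟩)]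
  refine ⟨B, hB, hBpos, fun i hi j hj hij => ?_⟩
  by_cases hjv : j = v
  · subst hjv
    exact hcol i hi (hsymm _ _ hij)
  by_cases hiv : i = v
  · subst hiv
    rw [← hB.apply, ← hH.apply, hcol j hj hij]
  have hiT := Finset.mem_erase.2 ⟨hiv, hi⟩
  have hjT := Finset.mem_erase.2 ⟨hjv, hj⟩
  rw [hBA i hiT j hjT, hAH i hiT j hjT hij]

/-- Off-diagonal entries outside a positive definite block can be prescribed, when the remaining
diagonal entries are free. -/
theorem IsPosDefOn.exists_extension [DecidableEq V] {S : Finset V} (hA : A.IsHermitian)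
    (hpos : IsPosDefOn S A) (hH : H.IsHermitian) :
    ∃ B : Matrix V V ℂ, B.IsHermitian ∧ IsPosDefOn Finset.univ B ∧
      (∀ i ∈ S, ∀ j ∈ S, B i j = A i j) ∧
      ∀ i j, i ≠ j → ¬ (i ∈ S ∧ j ∈ S) → B i j = H i j := by
  have key : ∀ T : Finset V, ∃ B : Matrix V V ℂ, B.IsHermitian ∧ IsPosDefOn (S ∪ T) B ∧
      (∀ i ∈ S, ∀ j ∈ S, B i j = A i j) ∧
      ∀ i ∈ S ∪ T, ∀ j ∈ S ∪ T, i ≠ j → ¬ (i ∈ S ∧ j ∈ S) → B i j = H i j := by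
    intro T
    induction T using Finset.induction_on with
    | empty =>
      refine ⟨A, hA, by simpa using hpos, fun _ _ _ _ => rfl, fun i hi j hj _ h => ?_⟩
      exact absurd ⟨by simpa using hi, by simpa using hj⟩ h
    | insert v T _ ih =>
      obtain ⟨B, hB, hBpos, hBA, hBH⟩ := ih
      rw [Finset.union_insert]
      by_cases hvS : v ∈ S ∪ T
      · rw [Finset.insert_eq_of_mem hvS]
        exact ⟨B, hB, hBpos, hBA, hBH⟩
      obtain ⟨y, hy, hBy⟩ := hBpos.exists_mulVec_eq fun i => H i v
      -- The diagonal entry at `v` is unconstrained, so any value above `y* B y` serves.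
      obtain ⟨D, hD, hDpos, hDB, hDv, -⟩ := hBpos.exists_border hB hvS hy (lt_add_one _)
      refine ⟨D, hD, hDpos, fun i hi j hj => ?_, fun i hi j hj hij hS => ?_⟩
      · rw [hDB i (Finset.mem_union_left _ hi) j (Finset.mem_union_left _ hj), hBA i hi j hj]
      · rcases Finset.mem_insert.1 hi with hiv | hi' <;>
          rcases Finset.mem_insert.1 hj with hjv | hj'
        · exact absurd (hiv.trans hjv.symm) hij
        · rw [hiv, ← hD.apply, ← hH.apply, hDv j hj', hBy j hj']
        · rw [hjv, hDv i hi', hBy i hi']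
        · rw [hDB i hi' j hj', hBH i hi' j hj' hij hS]
  obtain ⟨B, hB, hBpos, hBA, hBH⟩ := key Finset.univ
  rw [Finset.union_eq_right.2 (Finset.subset_univ S)] at hBpos hBH
  exact ⟨B, hB, hBpos, hBA, fun i j => hBH i (Finset.mem_univ _) j (Finset.mem_univ _)⟩

end HermitianCompletion

/-! ### The open sector as an intersection of half-planes. -/

section Sectors

variable {α β : ℝ}

/-- The open sector `{r exp (i a) | r > 0, α < a < β}`, for `0 < β - α < π`, as an intersection of
two open half-planes. -/
def IsInSector (α β : ℝ) (z : ℂ) : Prop :=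
  0 < (star (Complex.exp (Complex.I * α)) * z).im ∧ (star (Complex.exp (Complex.I * β)) * z).im < 0

theorem im_star_exp_mul_exp (θ a : ℝ) :
    (star (Complex.exp (Complex.I * θ)) * Complex.exp (Complex.I * a)).im = Real.sin (a - θ) := by
  have h : star (Complex.exp (Complex.I * θ)) * Complex.exp (Complex.I * a) =
      Complex.exp (((a - θ : ℝ) : ℂ) * Complex.I) := by
    rw [RCLike.star_def, ← Complex.exp_conj, ← Complex.exp_add]
    congr 1
    simp only [map_mul, Complex.conj_I, Complex.conj_ofReal]
    push_cast
    ring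
  rw [h, Complex.exp_ofReal_mul_I_im]

theorem isInSector_exp (hlt : β - α < Real.pi) {a : ℝ} (ha : a ∈ Set.Ioo α β) :
    IsInSector α β (Complex.exp (Complex.I * a)) := by
  obtain ⟨h1, h2⟩ := ha
  constructor
  · rw [im_star_exp_mul_exp]
    exact Real.sin_pos_of_pos_of_lt_pi (by linarith) (by linarith)
  · rw [im_star_exp_mul_exp]
    exact Real.sin_neg_of_neg_of_neg_pi_lt (by linarith) (by linarith)

theorem IsInSector.exists_polar (hpos : 0 < β - α) {z : ℂ}
    (hz : IsInSector α β z) :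
    ∃ r a : ℝ, 0 < r ∧ a ∈ Set.Ioo α β ∧ z = r * Complex.exp (Complex.I * a) := by
  obtain ⟨w, hw⟩ : ∃ w, w = star (Complex.exp (Complex.I * α)) * z := ⟨_, rfl⟩
  have hunit : Complex.exp (Complex.I * α) * star (Complex.exp (Complex.I * α)) = 1 := by
    rw [RCLike.star_def, Complex.mul_conj, Complex.normSq_eq_norm_sq, mul_comm Complex.I,
      Complex.norm_exp_ofReal_mul_I]
    simp
  have hzw : z = Complex.exp (Complex.I * α) * w := by
    rw [hw, ← mul_assoc, hunit, one_mul]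
  have hwim : 0 < w.im := hw ▸ hz.1
  have hw0 : w ≠ 0 := fun h => by simp [h] at hwim
  have hr : 0 < ‖w‖ := norm_pos_iff.2 hw0
  have harg : 0 < w.arg := by
    refine lt_of_le_of_ne (Complex.arg_nonneg_iff.2 hwim.le) fun h => ?_
    exact hwim.ne' (Complex.arg_eq_zero_iff.1 h.symm).2
  have harg' : w.arg < Real.pi := Complex.arg_lt_pi_iff.2 (Or.inr hwim.ne')
  have hpolar : z = ‖w‖ * Complex.exp (Complex.I * ((α + w.arg : ℝ) : ℂ)) := by
    conv_lhs => rw [hzw, ← Complex.norm_mul_exp_arg_mul_I w]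
    push_cast
    rw [mul_add, Complex.exp_add, mul_comm Complex.I (w.arg : ℂ)]
    ring
  -- If the angle `α + w.arg` were at least `β`, it would exceed `β` by less than `π`, and the
  -- nonnegative sine would contradict the second half-plane.
  refine ⟨‖w‖, α + w.arg, hr, ⟨by linarith, ?_⟩, hpolar⟩
  by_contra hge
  push Not at hge
  have h2 := hz.2
  rw [hpolar, mul_left_comm, Complex.im_ofReal_mul,
    im_star_exp_mul_exp] at h2
  have h3 : 0 ≤ Real.sin (α + w.arg - β) :=
    Real.sin_nonneg_of_nonneg_of_le_pi (by linarith) (by linarith)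
  have := mul_nonneg hr.le h3
  linarith

end Sectors

/-! ### Phases and values of the quadratic form. -/

section QuadraticForm

theorem reindex_congruenceCanonicalForm {ι : Type*} [DecidableEq ι] {l : ℕ} (a : Fin l → ℝ) (γ : ℝ)
    (e : (Fin 0 ⊕ (Fin l ⊕ (Fin 2 × Fin 0))) ≃ ι) :
    Matrix.reindex e e (congruenceCanonicalForm 0 l 0 a γ) =
      Matrix.diagonal fun i => Sum.elim (fun _ => (0 : ℂ))
        (Sum.elim (fun j => Complex.exp (Complex.I * a j)) fun _ => 0) (e.symm i) := by
  ext i j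
  obtain ⟨i, rfl⟩ := e.surjective i
  obtain ⟨j, rfl⟩ := e.surjective j
  rcases i with i | i | i
  · exact i.elim0
  · rcases j with j | j | j
    · exact j.elim0
    · by_cases hij : i = j <;> simp [congruenceCanonicalForm, hij]
    · exact j.2.elim0
  · exact i.2.elim0

variable {ι : Type*} [Fintype ι] {α β : ℝ} {A T : Matrix ι ι ℂ}

theorem star_dotProduct_congruence_mulVec (T B : Matrix ι ι ℂ) (x : ι → ℂ) :
    star x ⬝ᵥ ((T * B * Tᴴ) *ᵥ x) = star (Tᴴ *ᵥ x) ⬝ᵥ (B *ᵥ (Tᴴ *ᵥ x)) := by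
  rw [Matrix.star_mulVec, Matrix.conjTranspose_conjTranspose, ← Matrix.dotProduct_mulVec,
    Matrix.mulVec_mulVec, Matrix.mulVec_mulVec]

theorem exists_conjTranspose_mulVec_eq [DecidableEq ι] (hT : IsUnit T) (y : ι → ℂ) :
    ∃ x, Tᴴ *ᵥ x = y := by
  have h : IsUnit Tᴴ := hT.star
  refine ⟨(Tᴴ)⁻¹ *ᵥ y, ?_⟩
  rw [Matrix.mulVec_mulVec, Matrix.mul_nonsing_inv _ ((Matrix.isUnit_iff_isUnit_det _).1 h),
    Matrix.one_mulVec]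

theorem conjTranspose_mulVec_ne_zero [DecidableEq ι] (hT : IsUnit T) {x : ι → ℂ} (hx : x ≠ 0) :
    Tᴴ *ᵥ x ≠ 0 := by
  have h : IsUnit Tᴴ := hT.star
  intro h0
  apply hx
  rw [← Matrix.one_mulVec x, ← Matrix.nonsing_inv_mul _ ((Matrix.isUnit_iff_isUnit_det _).1 h),
    ← Matrix.mulVec_mulVec, h0, Matrix.mulVec_zero]

theorem star_dotProduct_self_eq_ofReal (x : ι → ℂ) :
    star x ⬝ᵥ x = ((∑ i, ‖x i‖ ^ 2 : ℝ) : ℂ) := by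
  simp [dotProduct, Complex.conj_mul']

theorem sum_norm_sq_pos {x : ι → ℂ} (hx : x ≠ 0) : 0 < ∑ i, ‖x i‖ ^ 2 := by
  obtain ⟨i, hi⟩ := Function.ne_iff.1 hx
  exact Finset.sum_pos' (fun _ _ => by positivity)
    ⟨i, Finset.mem_univ _, pow_pos (norm_pos_iff.2 hi) 2⟩

theorem star_dotProduct_mulVec_ne_zero (hA : (0 : ℂ) ∉ numericalRange A) {x : ι → ℂ} (hx : x ≠ 0) :
    star x ⬝ᵥ (A *ᵥ x) ≠ 0 := by
  intro h0
  have hs := sum_norm_sq_pos hx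
  set s := ∑ i, ‖x i‖ ^ 2 with hsdef
  refine hA ⟨((Real.sqrt s)⁻¹ : ℂ) • x, ?_, ?_⟩
  · rw [star_smul, smul_dotProduct, dotProduct_smul, star_dotProduct_self_eq_ofReal, ← hsdef]
    simp only [smul_eq_mul, RCLike.star_def, map_inv₀, Complex.conj_ofReal]
    have h1 : ((Real.sqrt s : ℝ) : ℂ) * (Real.sqrt s : ℝ) = (s : ℂ) := by
      rw [← Complex.ofReal_mul, Real.mul_self_sqrt hs.le]
    have h2 : ((Real.sqrt s : ℝ) : ℂ) ≠ 0 := by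
      exact_mod_cast (Real.sqrt_pos.2 hs).ne'
    rw [← h1]
    field_simp
  · rw [star_smul, Matrix.mulVec_smul, smul_dotProduct, dotProduct_smul, h0, smul_zero, smul_zero]

theorem star_dotProduct_diagonal_mulVec [DecidableEq ι] (d y : ι → ℂ) :
    star y ⬝ᵥ (Matrix.diagonal d *ᵥ y) = ∑ i, ((‖y i‖ ^ 2 : ℝ) : ℂ) * d i := by
  refine Finset.sum_congr rfl fun i _ => ?_
  rw [Matrix.mulVec_diagonal, Pi.star_apply, RCLike.star_def, mul_left_comm, Complex.conj_mul']
  push_cast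
  ring

theorem isInSector_sum {d : ι → ℂ} (hd : ∀ i, IsInSector α β (d i)) {y : ι → ℂ} (hy : y ≠ 0) :
    IsInSector α β (∑ i, ((‖y i‖ ^ 2 : ℝ) : ℂ) * d i) := by
  obtain ⟨i, hi⟩ := Function.ne_iff.1 hy
  have hi' : 0 < ‖y i‖ ^ 2 := pow_pos (norm_pos_iff.2 hi) 2
  have key : ∀ u : ℂ, (u * ∑ i, ((‖y i‖ ^ 2 : ℝ) : ℂ) * d i).im =
      ∑ i, ‖y i‖ ^ 2 * (u * d i).im := by
    intro u
    rw [Finset.mul_sum, Complex.im_sum]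
    refine Finset.sum_congr rfl fun i _ => ?_
    rw [mul_left_comm, Complex.im_ofReal_mul]
  constructor
  · rw [key]
    exact Finset.sum_pos' (fun j _ => mul_nonneg (by positivity) (hd j).1.le)
      ⟨i, Finset.mem_univ _, mul_pos hi' (hd i).1⟩
  · rw [key]
    exact Finset.sum_neg' (fun j _ => mul_nonpos_of_nonneg_of_nonpos (by positivity) (hd j).2.le)
      ⟨i, Finset.mem_univ _, mul_neg_of_pos_of_neg hi' (hd i).2⟩

/-- Only the unimodular `1 × 1` blocks of the canonical form survive, so `x* A x` is a nonnegative
combination, not all coefficients zero, of the numbers `exp (i a j)` in the convex sector. -/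
theorem isInSector_of_mem_strictPhaseBoundedCone [DecidableEq ι] (hlt : β - α < Real.pi)
    (hA : A ∈ strictPhaseBoundedCone ι α β) {x : ι → ℂ} (hx : x ≠ 0) :
    IsInSector α β (star x ⬝ᵥ (A *ᵥ x)) := by
  obtain ⟨⟨-, hzero⟩, φ, ⟨-, ⟨k, l, m, a, γ, e, ⟨T, hT, rfl⟩, rfl⟩, -⟩, hIoo⟩ := hA
  -- The phases `γ ± π / 2` differ by `π`, more than the length of `(α, β)`.
  have hm : m = 0 := by
    by_contra hm
    have h1 := hIoo (γ + Real.pi / 2) (by simp [Multiset.mem_replicate, hm])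
    have h2 := hIoo (γ - Real.pi / 2) (by simp [Multiset.mem_replicate, hm])
    linarith [h1.1, h1.2, h2.1, h2.2]
  -- A zero block would give a nonzero vector at which the form vanishes, against `0 ∉ W(A)`.
  have hk : k = 0 := by
    by_contra hk
    let i₀ : ι := e (Sum.inl ⟨0, Nat.pos_of_ne_zero hk⟩)
    obtain ⟨y, hy⟩ := exists_conjTranspose_mulVec_eq hT (Pi.single i₀ (1 : ℂ))
    have hy0 : y ≠ 0 := by
      rintro rfl
      rw [Matrix.mulVec_zero] at hy
      have := congrFun hy i₀
      simp at this
    refine star_dotProduct_mulVec_ne_zero hzero hy0 ?_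
    rw [star_dotProduct_congruence_mulVec, hy]
    simp [i₀, congruenceCanonicalForm]
  subst hm hk
  rw [star_dotProduct_congruence_mulVec, reindex_congruenceCanonicalForm,
    star_dotProduct_diagonal_mulVec]
  refine isInSector_sum (fun i => ?_) (conjTranspose_mulVec_ne_zero hT hx)
  obtain ⟨i, rfl⟩ := e.surjective i
  rcases i with i | i | i
  · exact i.elim0
  · simpa using isInSector_exp hlt (hIoo (a i) (by simp))
  · exact i.2.elim0

/-- The closed sector contains no line: if `z` and `-z` both lie in it, `z` is parallel to both
boundary rays, which `sin (β - α) ≠ 0` forbids unless `z = 0`. -/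
theorem isSectorial_of_isInSector (hpos : 0 < β - α) (hlt : β - α < Real.pi)
    (hA : ∀ x : ι → ℂ, x ≠ 0 → IsInSector α β (star x ⬝ᵥ (A *ᵥ x))) : IsSectorial A := by
  have hzero : (0 : ℂ) ∉ numericalRange A := by
    rintro ⟨x, hx, h0⟩
    have hx0 : x ≠ 0 := by
      rintro rfl
      simp at hx
    have := (hA x hx0).1
    rw [h0] at this
    simp at this
  refine ⟨⟨fun h => hzero (interior_subset h), fun L hL => ?_⟩, hzero⟩
  have hcl : closure (angularNumericalRange A) ⊆
      {z | 0 ≤ (star (Complex.exp (Complex.I * α)) * z).im ∧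
        (star (Complex.exp (Complex.I * β)) * z).im ≤ 0} := by
    refine closure_minimal ?_ ?_
    · rintro z ⟨x, hx, rfl⟩
      exact ⟨(hA x hx).1.le, (hA x hx).2.le⟩
    · have hc : ∀ u : ℂ, Continuous fun z : ℂ => (u * z).im := fun u => by fun_prop
      exact (isClosed_le continuous_const (hc _)).inter (isClosed_le (hc _) continuous_const)
  rw [Submodule.eq_bot_iff]
  intro z hz
  by_contra hz0
  obtain ⟨h1, h2⟩ := hcl (hL hz)
  obtain ⟨h3, h4⟩ := hcl (hL (L.neg_mem hz))
  rw [mul_neg, Complex.neg_im] at h3 h4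
  have ha : (star (Complex.exp (Complex.I * α)) * z).im = 0 := by linarith
  have hb : (star (Complex.exp (Complex.I * β)) * z).im = 0 := by linarith
  have hz' : z = ‖z‖ * Complex.exp (Complex.I * (z.arg : ℝ)) := by
    rw [mul_comm Complex.I, Complex.norm_mul_exp_arg_mul_I]
  have hn : ‖z‖ ≠ 0 := norm_ne_zero_iff.2 hz0
  rw [hz', mul_left_comm, Complex.im_ofReal_mul, im_star_exp_mul_exp] at ha hb
  have ha' := (mul_eq_zero.1 ha).resolve_left hn
  have hb' := (mul_eq_zero.1 hb).resolve_left hn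
  have hsin : Real.sin (β - α) = 0 := by
    have : β - α = (z.arg - α) - (z.arg - β) := by ring
    rw [this, Real.sin_sub, ha', hb']
    ring
  exact (Real.sin_pos_of_pos_of_lt_pi hpos hlt).ne' hsin

open scoped MatrixOrder ComplexOrder in
/-- Simultaneous diagonalization by congruence of a positive definite and a Hermitian matrix. -/
theorem _root_.Matrix.PosDef.exists_simultaneous_diagonalization [DecidableEq ι]
    {P Q : Matrix ι ι ℂ} (hP : P.PosDef) (hQ : Q.IsHermitian) :
    ∃ (T : Matrix ι ι ℂ) (d : ι → ℂ), IsUnit T ∧ P = T * Tᴴ ∧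
      Q = T * Matrix.diagonal d * Tᴴ := by
  obtain ⟨C, hC⟩ := CStarAlgebra.nonneg_iff_eq_star_mul_self.mp hP.posSemidef.nonneg
  rw [Matrix.star_eq_conjTranspose] at hC
  have hCdet : IsUnit C.det := by
    have h := (Matrix.isUnit_iff_isUnit_det _).1 hP.isUnit
    rw [hC, Matrix.det_mul] at h
    exact isUnit_of_mul_isUnit_right h
  have hCdet' : IsUnit (Cᴴ).det := by
    rw [Matrix.det_conjTranspose]
    exact hCdet.star
  have hQ' : (C⁻¹ᴴ * Q * C⁻¹).IsHermitian :=
    Matrix.isHermitian_conjTranspose_mul_mul C⁻¹ hQ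
  -- With `P = C* C`, the unitary `U` diagonalizes `Q` transported by `C⁻¹`, and `T = C* U` does
  -- both jobs.
  obtain ⟨U, hU⟩ : ∃ U, U = hQ'.eigenvectorUnitary := ⟨_, rfl⟩
  have hspec := hQ'.spectral_theorem
  rw [← hU, Unitary.conjStarAlgAut_apply] at hspec
  have hUU : (U : Matrix ι ι ℂ) * (U : Matrix ι ι ℂ)ᴴ = 1 := Unitary.mul_star_self_of_mem U.2
  refine ⟨Cᴴ * U, RCLike.ofReal ∘ hQ'.eigenvalues, ?_, ?_, ?_⟩
  rotate_left
  · rw [Matrix.conjTranspose_mul, Matrix.conjTranspose_conjTranspose, mul_assoc,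
      ← mul_assoc (U : Matrix ι ι ℂ), hUU, one_mul, hC]
  · rw [Matrix.conjTranspose_mul, Matrix.conjTranspose_conjTranspose]
    calc Q = Cᴴ * (C⁻¹ᴴ * Q * C⁻¹) * C := by
          rw [Matrix.conjTranspose_nonsing_inv]
          simp only [mul_assoc, Matrix.nonsing_inv_mul _ hCdet, mul_one]
          rw [← mul_assoc, Matrix.mul_nonsing_inv _ hCdet', one_mul]
      _ = _ := by
          rw [congrArg (fun M => Cᴴ * M * C) hspec]
          simp only [mul_assoc, Matrix.star_eq_conjTranspose]
  · exact ((Matrix.isUnit_iff_isUnit_det _).2 hCdet').mul (IsUnit.of_mul_eq_one _ hUU)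

end QuadraticForm

/-! ### A matrix and its two rotated imaginary parts. -/

section RotatedParts

variable {ι : Type*} {A P Q : Matrix ι ι ℂ} {u E F : ℂ}

/-- The Hermitian matrix `(u A - (u A)*) / 2i`. -/
noncomputable def rotatedIm (u : ℂ) (A : Matrix ι ι ℂ) : Matrix ι ι ℂ :=
  Matrix.of fun i j => (u * A i j - star u * star (A j i)) / (2 * Complex.I)

theorem rotatedIm_isHermitian (u : ℂ) (A : Matrix ι ι ℂ) : (rotatedIm u A).IsHermitian := by
  ext i j
  simp only [rotatedIm, Matrix.conjTranspose_apply, Matrix.of_apply, RCLike.star_def, map_div₀,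
    map_sub, map_mul, Complex.conj_conj, Complex.conj_I, map_ofNat]
  rw [mul_neg, div_neg, ← neg_div, neg_sub]

theorem quadratic_rotatedIm_re [Fintype ι] (u : ℂ) (A : Matrix ι ι ℂ) (x : ι → ℂ) :
    (star x ⬝ᵥ (rotatedIm u A *ᵥ x)).re = (u * (star x ⬝ᵥ (A *ᵥ x))).im := by
  have h : rotatedIm u A = (2 * Complex.I)⁻¹ • (u • A - star u • Aᴴ) := by
    ext i j
    simp [rotatedIm, div_eq_inv_mul]
  have h2 : star x ⬝ᵥ (Aᴴ *ᵥ x) = star (star x ⬝ᵥ (A *ᵥ x)) := by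
    rw [Matrix.star_dotProduct, Matrix.star_mulVec, Matrix.conjTranspose_conjTranspose,
      Matrix.dotProduct_mulVec]
  rw [h, Matrix.smul_mulVec, Matrix.sub_mulVec, Matrix.smul_mulVec, Matrix.smul_mulVec,
    dotProduct_smul, dotProduct_sub, dotProduct_smul, dotProduct_smul, h2]
  generalize star x ⬝ᵥ (A *ᵥ x) = z
  simp only [smul_eq_mul]
  rw [← star_mul', RCLike.star_def, Complex.sub_conj, mul_inv]
  field_simp
  simp

/-- The matrix with prescribed rotated imaginary parts `P` (for `star E`) and `Q` (for
`-star F`). -/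
noncomputable def ofRotatedIm (E F : ℂ) (P Q : Matrix ι ι ℂ) : Matrix ι ι ℂ :=
  Matrix.of fun i j => 2 * Complex.I / (F * star E - E * star F) * (F * P i j + E * Q i j)

/-- In `F P + E Q` the contributions of `A*` cancel, leaving `A` times `(F Ē - E F̄) / 2i`. -/
theorem ofRotatedIm_rotatedIm (hD : F * star E - E * star F ≠ 0) :
    ofRotatedIm E F (rotatedIm (star E) A) (rotatedIm (-star F) A) = A := by
  ext i j
  simp only [ofRotatedIm, rotatedIm, Matrix.of_apply, star_star, star_neg]
  have hI := Complex.I_ne_zero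
  field_simp
  ring

/-- The coefficient is real, which is what lets the rotated imaginary parts of `ofRotatedIm E F P Q`
be read off when `P` and `Q` are Hermitian. -/
theorem star_two_I_div (E F : ℂ) : star (2 * Complex.I / (F * star E - E * star F)) =
    2 * Complex.I / (F * star E - E * star F) := by
  simp only [RCLike.star_def, map_div₀, map_sub, map_mul, Complex.conj_conj, Complex.conj_I,
    map_ofNat]
  rw [← neg_sub, mul_neg, neg_div_neg_eq, mul_comm E, mul_comm F]

theorem rotatedIm_ofRotatedIm_left (hD : F * star E - E * star F ≠ 0)
    (hP : P.IsHermitian) (hQ : Q.IsHermitian) :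
    rotatedIm (star E) (ofRotatedIm E F P Q) = P := by
  ext i j
  simp only [ofRotatedIm, rotatedIm, Matrix.of_apply, star_star, star_mul', star_two_I_div,
    star_add, hP.apply, hQ.apply]
  have hI : (2 * Complex.I) ≠ 0 := by simp
  have hk := div_mul_cancel₀ (2 * Complex.I) hD
  generalize 2 * Complex.I / (F * star E - E * star F) = k at hk ⊢
  rw [div_eq_iff hI]
  linear_combination P i j * hk

theorem rotatedIm_ofRotatedIm_right (hD : F * star E - E * star F ≠ 0)
    (hP : P.IsHermitian) (hQ : Q.IsHermitian) :
    rotatedIm (-star F) (ofRotatedIm E F P Q) = Q := by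
  ext i j
  simp only [ofRotatedIm, rotatedIm, Matrix.of_apply, star_star, star_neg, star_mul',
    star_two_I_div, star_add, hP.apply, hQ.apply]
  have hI : (2 * Complex.I) ≠ 0 := by simp
  have hk := div_mul_cancel₀ (2 * Complex.I) hD
  generalize 2 * Complex.I / (F * star E - E * star F) = k at hk ⊢
  rw [div_eq_iff hI]
  linear_combination Q i j * hk

end RotatedParts

/-! ### The cone described by the quadratic form. -/

section Characterization

variable {ι : Type*} [Fintype ι] {α β : ℝ} {A : Matrix ι ι ℂ}

/-- The expression equals `2i sin (β - α)`. -/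
theorem exp_mul_star_exp_sub_ne_zero (hpos : 0 < β - α) (hlt : β - α < Real.pi) :
    Complex.exp (Complex.I * β) * star (Complex.exp (Complex.I * α)) -
      Complex.exp (Complex.I * α) * star (Complex.exp (Complex.I * β)) ≠ 0 := by
  intro h
  have h1 : Complex.exp (Complex.I * α) * star (Complex.exp (Complex.I * β)) =
      star (star (Complex.exp (Complex.I * α)) * Complex.exp (Complex.I * β)) := by
    rw [star_mul', star_star]
  rw [h1, mul_comm] at h
  have h2 := Complex.sub_conj (star (Complex.exp (Complex.I * α)) * Complex.exp (Complex.I * β))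
  rw [← RCLike.star_def, h, im_star_exp_mul_exp] at h2
  have := (Real.sin_pos_of_pos_of_lt_pi hpos hlt).ne'
  simp [this, Complex.I_ne_zero, -Complex.ofReal_sin, -Complex.ofReal_sub] at h2

theorem isInSector_iff_rotatedIm (x : ι → ℂ) :
    IsInSector α β (star x ⬝ᵥ (A *ᵥ x)) ↔
      0 < (star x ⬝ᵥ (rotatedIm (star (Complex.exp (Complex.I * α))) A *ᵥ x)).re ∧
      0 < (star x ⬝ᵥ (rotatedIm (-star (Complex.exp (Complex.I * β))) A *ᵥ x)).re := by
  rw [quadratic_rotatedIm_re, quadratic_rotatedIm_re, IsInSector, neg_mul, Complex.neg_im,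
    neg_pos]

open scoped ComplexOrder in
theorem _root_.Matrix.IsHermitian.posDef_of_re_pos {P : Matrix ι ι ℂ} (hP : P.IsHermitian)
    (h : ∀ x : ι → ℂ, x ≠ 0 → 0 < (star x ⬝ᵥ (P *ᵥ x)).re) : P.PosDef := by
  refine .of_dotProduct_mulVec_pos hP fun x hx => ?_
  have h1 : star (star x ⬝ᵥ (P *ᵥ x)) = star x ⬝ᵥ (P *ᵥ x) :=
    (hP.star_dotProduct_mulVec x x).symm
  rw [← Complex.conj_eq_iff_re.1 h1]
  exact_mod_cast h x hx

open scoped ComplexOrder in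
theorem mem_strictPhaseBoundedCone_iff [DecidableEq ι] (hpos : 0 < β - α)
    (hlt : β - α < Real.pi) :
    A ∈ strictPhaseBoundedCone ι α β ↔
      ∀ x : ι → ℂ, x ≠ 0 → IsInSector α β (star x ⬝ᵥ (A *ᵥ x)) := by
  refine ⟨fun hA x hx => isInSector_of_mem_strictPhaseBoundedCone hlt hA hx, fun hA => ?_⟩
  have hsect := isSectorial_of_isInSector hpos hlt hA
  have hP : (rotatedIm (star (Complex.exp (Complex.I * α))) A).PosDef :=
    (rotatedIm_isHermitian _ _).posDef_of_re_pos fun x hx =>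
      ((isInSector_iff_rotatedIm x).1 (hA x hx)).1
  have hAPQ := ofRotatedIm_rotatedIm (A := A) (exp_mul_star_exp_sub_ne_zero hpos hlt)
  obtain ⟨T, d, hT, hTP, hTQ⟩ := hP.exists_simultaneous_diagonalization
    (rotatedIm_isHermitian (-star (Complex.exp (Complex.I * β))) A)
  obtain ⟨z, hz⟩ : ∃ z : ι → ℂ, A = T * Matrix.diagonal z * Tᴴ := by
    generalize Complex.exp (Complex.I * α) = E at *
    generalize Complex.exp (Complex.I * β) = F at *
    -- `A` is a linear combination of `P = T T*` and `Q = T diag(d) T*`, so the same congruence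
    -- diagonalizes it.
    refine ⟨fun i => 2 * Complex.I / (F * star E - E * star F) * (F + E * d i), ?_⟩
    have h1 : Matrix.diagonal
        (fun i => 2 * Complex.I / (F * star E - E * star F) * (F + E * d i)) =
        (2 * Complex.I / (F * star E - E * star F)) • (F • (1 : Matrix ι ι ℂ) +
          E • Matrix.diagonal d) := by
      ext i j
      by_cases hij : i = j <;> simp [hij]
    have h2 : ofRotatedIm E F (T * Tᴴ) (T * Matrix.diagonal d * Tᴴ) =
        (2 * Complex.I / (F * star E - E * star F)) • (F • (T * Tᴴ) +
          E • (T * Matrix.diagonal d * Tᴴ)) := by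
      ext i j
      simp [ofRotatedIm]
    rw [← hTP, ← hTQ, hAPQ, hTP, hTQ] at h2
    rw [h1, h2]
    simp [mul_add, add_mul]
  have hzs : ∀ i, IsInSector α β (z i) := by
    intro i
    -- Each `z i` is itself a value of the form, at the `x` with `T* x = e_i`.
    obtain ⟨x, hx⟩ := exists_conjTranspose_mulVec_eq hT (Pi.single i (1 : ℂ))
    have hx0 : x ≠ 0 := by
      rintro rfl
      rw [Matrix.mulVec_zero] at hx
      simpa using congrFun hx i
    have h := hA x hx0
    rw [hz, star_dotProduct_congruence_mulVec, hx] at h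
    simpa using h
  choose r a hr ha hza using fun i => (hzs i).exists_polar hpos
  obtain ⟨e₀⟩ : Nonempty (Fin (Fintype.card ι) ≃ ι) := ⟨(Fintype.equivFin ι).symm⟩
  let e : (Fin 0 ⊕ (Fin (Fintype.card ι) ⊕ (Fin 2 × Fin 0))) ≃ ι :=
    (Equiv.emptySum _ _).trans ((Equiv.sumEmpty _ _).trans e₀)
  have hmem : ∀ x ∈ Finset.univ.val.map (a ∘ e₀) + Multiset.replicate 0 ((0 : ℝ) + Real.pi / 2) +
      Multiset.replicate 0 ((0 : ℝ) - Real.pi / 2), x ∈ Set.Ioo α β := by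
    intro x hx
    simp only [Multiset.replicate_zero, add_zero, Multiset.mem_map] at hx
    obtain ⟨j, -, rfl⟩ := hx
    exact ha _
  -- The moduli `r i` are absorbed into the congruence through their square roots, leaving the
  -- canonical form with `k = m = 0`; `γ = 0` is a dummy value.
  refine ⟨hsect, _, ⟨hsect.1.1, ⟨0, Fintype.card ι, 0, a ∘ e₀, 0, e,
    ⟨T * Matrix.diagonal fun i => ((Real.sqrt (r i) : ℝ) : ℂ), ?_, ?_⟩, rfl⟩, α, fun x hx => ?_⟩,
    hmem⟩
  · refine hT.mul ?_
    rw [Matrix.isUnit_diagonal, Pi.isUnit_iff]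
    exact fun i => isUnit_iff_ne_zero.2 (Complex.ofReal_ne_zero.2 (Real.sqrt_pos.2 (hr i)).ne')
  · rw [reindex_congruenceCanonicalForm, hz, Matrix.conjTranspose_mul,
      Matrix.diagonal_conjTranspose]
    have h3 : Matrix.diagonal z = Matrix.diagonal (fun i => ((Real.sqrt (r i) : ℝ) : ℂ)) *
        Matrix.diagonal (fun i => Sum.elim (fun _ => (0 : ℂ))
        (Sum.elim (fun j => Complex.exp (Complex.I * (a ∘ e₀) j)) fun _ => 0) (e.symm i)) *
        Matrix.diagonal (star fun i => ((Real.sqrt (r i) : ℝ) : ℂ)) := by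
      rw [Matrix.diagonal_mul_diagonal, Matrix.diagonal_mul_diagonal]
      congr 1
      funext i
      have h4 : ((Real.sqrt (r i) : ℝ) : ℂ) * (Real.sqrt (r i) : ℝ) = r i := by
        rw [← Complex.ofReal_mul, Real.mul_self_sqrt (hr i).le]
      obtain ⟨k, rfl⟩ := e₀.surjective i
      have h5 : e.symm (e₀ k) = Sum.inr (Sum.inl k) := by
        rw [Equiv.symm_apply_eq]; rfl
      rw [h5, hza, ← h4]
      simp only [Sum.elim_inr, Sum.elim_inl, Function.comp_apply, Pi.star_apply, RCLike.star_def,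
        Complex.conj_ofReal]
      ring
    rw [h3]
    simp only [mul_assoc]
  · have := hmem x hx
    exact ⟨this.1.le, by linarith [this.2]⟩

end Characterization

/-! ### Principal submatrices and the completion theorem. -/

section Completion

theorem cliqueSubmatrix_eq_submatrix {V : Type*} {G : Digraph V} {A : Matrix V V ℂ} {C : PartialMatrix G}
    (hA : IsCompletion C A) (K : Finset V) (hK : IsClique G K) :
    cliqueSubmatrix C K hK = A.submatrix (fun i : K => (i : V)) (fun i : K => (i : V)) := by
  ext i j
  exact (hA _ _ _).symm

variable {V : Type*} [Fintype V] {A : Matrix V V ℂ} {α β : ℝ}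

theorem quadratic_submatrix_of_supported {K : Finset V} {x : V → ℂ} (hx : ∀ i ∉ K, x i = 0) :
    star (fun i : K => x i) ⬝ᵥ (A.submatrix (fun i : K => (i : V)) (fun i : K => (i : V)) *ᵥ
      fun i : K => x i) = star x ⬝ᵥ (A *ᵥ x) := by
  have key : ∀ f : V → ℂ, (∀ i ∉ K, f i = 0) → ∑ i : K, f i = ∑ i, f i := fun f hf => by
    rw [Finset.sum_coe_sort K f]
    exact Finset.sum_subset (Finset.subset_univ K) fun i _ hi => hf i hi
  have h1 : ∀ i, ∑ j : K, A i j * x j = ∑ j, A i j * x j := fun i =>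
    key (fun j => A i j * x j) fun j hj => by simp [hx j hj]
  have h2 := key (fun i => star (x i) * ∑ j, A i j * x j) fun i hi => by simp [hx i hi]
  simp only [← h1] at h2
  simp only [← h1, dotProduct, Matrix.mulVec, Matrix.submatrix_apply, Pi.star_apply]
  exact h2

/-- A principal submatrix lies in the cone exactly when both rotated imaginary parts of the matrix
are positive definite on its index set. -/
theorem submatrix_mem_strictPhaseBoundedCone_iff [DecidableEq V] (hpos : 0 < β - α)
    (hlt : β - α < Real.pi) (K : Finset V) :
    A.submatrix (fun i : K => (i : V)) (fun i : K => (i : V)) ∈ strictPhaseBoundedCone K α β ↔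
      IsPosDefOn K (rotatedIm (star (Complex.exp (Complex.I * α))) A) ∧
      IsPosDefOn K (rotatedIm (-star (Complex.exp (Complex.I * β))) A) := by
  have hform : A.submatrix (fun i : K => (i : V)) (fun i : K => (i : V)) ∈
      strictPhaseBoundedCone K α β ↔
      ∀ x : V → ℂ, (∀ i ∉ K, x i = 0) → x ≠ 0 → IsInSector α β (star x ⬝ᵥ (A *ᵥ x)) := by
    rw [mem_strictPhaseBoundedCone_iff hpos hlt]
    refine ⟨fun h x hx h0 => ?_, fun h y h0 => ?_⟩
    · rw [← quadratic_submatrix_of_supported hx]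
      refine h _ fun h1 => h0 (funext fun i => ?_)
      by_cases hi : i ∈ K
      · exact congrFun h1 ⟨i, hi⟩
      · exact hx i hi
    · obtain ⟨x, hxdef⟩ : ∃ x : V → ℂ, x = fun i => if hi : i ∈ K then y ⟨i, hi⟩ else 0 :=
        ⟨_, rfl⟩
      have hx : ∀ i ∉ K, x i = 0 := fun i hi => by simp [hxdef, hi]
      have hy : (fun i : K => x i) = y := funext fun i => by simp [hxdef]
      rw [← hy, quadratic_submatrix_of_supported hx]
      refine h x hx fun h1 => h0 ?_
      rw [← hy, h1]
      rfl
  rw [hform]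
  simp only [isInSector_iff_rotatedIm, IsPosDefOn]
  exact ⟨fun h => ⟨fun x hx h0 => (h x hx h0).1, fun x hx h0 => (h x hx h0).2⟩,
    fun h x hx h0 => ⟨h.1 x hx h0, h.2 x hx h0⟩⟩

theorem mem_strictPhaseBoundedCone_iff_isPosDefOn [DecidableEq V] (hpos : 0 < β - α)
    (hlt : β - α < Real.pi) :
    A ∈ strictPhaseBoundedCone V α β ↔
      IsPosDefOn Finset.univ (rotatedIm (star (Complex.exp (Complex.I * α))) A) ∧
      IsPosDefOn Finset.univ (rotatedIm (-star (Complex.exp (Complex.I * β))) A) := by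
  rw [mem_strictPhaseBoundedCone_iff hpos hlt]
  simp only [isInSector_iff_rotatedIm, IsPosDefOn]
  exact ⟨fun h => ⟨fun x _ h0 => (h x h0).1, fun x _ h0 => (h x h0).2⟩,
    fun h x h0 => ⟨h.1 x (by simp) h0, h.2 x (by simp) h0⟩⟩

end Completion

end PhaseCompletion

theorem mainTheorem5 {V : Type*} [Fintype V] [DecidableEq V] (G : Digraph V)
    (hund : PhaseCompletion.IsUndirected (PhaseCompletion.reflexivePart G))
    (hchord : PhaseCompletion.IsChordal (PhaseCompletion.reflexivePart G))
    (α β : ℝ) (hpos : 0 < β - α) (hlt : β - α < Real.pi)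
    (C : PhaseCompletion.PartialMatrix G) :
    (∃ A : Matrix V V ℂ, PhaseCompletion.IsCompletion C A ∧
        A ∈ PhaseCompletion.strictPhaseBoundedCone V α β) ↔
      ∀ (K : Finset V) (hK : PhaseCompletion.IsClique G K),
        (K : Set V) ⊆ PhaseCompletion.reflexiveVertices G →
          PhaseCompletion.cliqueSubmatrix C K hK ∈
            PhaseCompletion.strictPhaseBoundedCone K α β := by
  open PhaseCompletion in
  classical
  constructor
  · rintro ⟨A, hA, hmem⟩ K hK -
    rw [cliqueSubmatrix_eq_submatrix hA, submatrix_mem_strictPhaseBoundedCone_iff hpos hlt]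
    obtain ⟨h1, h2⟩ := (mem_strictPhaseBoundedCone_iff_isPosDefOn hpos hlt).1 hmem
    exact ⟨h1.mono (Finset.subset_univ _), h2.mono (Finset.subset_univ _)⟩
  intro hcl
  -- Zero is an arbitrary filling. The clique blocks do not see it; it matters only for an edge
  -- whose reverse is unspecified, which has an endpoint without a loop, and there any off-diagonal
  -- value is admissible.
  obtain ⟨A, hA⟩ : ∃ A : Matrix V V ℂ, IsCompletion C A :=
    ⟨Matrix.of fun i j => if h : G.Adj i j then C i j h else 0, fun i j h => by simp [h]⟩
  let S : Finset V := Finset.univ.filter fun v => G.Adj v v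
  have hS : ∀ v, v ∈ S ↔ G.Adj v v := fun v => by simp [S]
  let R : V → V → Prop := fun i j => G.Adj i j ∧ G.Adj i i ∧ G.Adj j j
  have hsymm : ∀ i j, R i j → R j i := fun i j h =>
    ⟨hund ⟨i, h.2.1⟩ ⟨j, h.2.2⟩ h.1, h.2.2, h.2.1⟩
  have hrefl : ∀ i ∈ S, R i i := fun i hi => ⟨(hS i).1 hi, (hS i).1 hi, (hS i).1 hi⟩
  have hchordS : IsChordalOn R (S : Set V) := by
    intro m v hm hv hinj hadj
    have hvS : ∀ i, G.Adj (v i) (v i) := fun i => (hS _).1 (Finset.mem_coe.1 (hv i))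
    obtain ⟨i, j, h1, h2, h3⟩ := hchord m (fun i => ⟨v i, hvS i⟩) hm
      ⟨fun i j h => hinj (congrArg Subtype.val h), fun i j h => (hadj i j h).1⟩
    exact ⟨i, j, h1, h2, h3, hvS i, hvS j⟩
  have hclique : ∀ K ⊆ S, (∀ i ∈ K, ∀ j ∈ K, R i j) →
      IsPosDefOn K (rotatedIm (star (Complex.exp (Complex.I * α))) A) ∧
      IsPosDefOn K (rotatedIm (-star (Complex.exp (Complex.I * β))) A) := by
    intro K hKS hKR
    have hK : IsClique G K := fun i hi j hj => (hKR i hi j hj).1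
    have h := hcl K hK fun i hi => (hS i).1 (hKS hi)
    rwa [cliqueSubmatrix_eq_submatrix hA,
      submatrix_mem_strictPhaseBoundedCone_iff hpos hlt] at h
  have hpart : ∀ H : Matrix V V ℂ, H.IsHermitian →
      (∀ K ⊆ S, (∀ i ∈ K, ∀ j ∈ K, R i j) → IsPosDefOn K H) →
      ∃ B : Matrix V V ℂ, B.IsHermitian ∧ IsPosDefOn Finset.univ B ∧
        ∀ i j, G.Adj i j → B i j = H i j := by
    intro H hH hHK
    obtain ⟨D, hD, hDpos, hDH⟩ := exists_isPosDefOn_of_isChordalOn hsymm hH S hchordS hrefl hHK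
    obtain ⟨B, hB, hBpos, hBD, hBH⟩ := hDpos.exists_extension hD hH
    refine ⟨B, hB, hBpos, fun i j hij => ?_⟩
    by_cases h : i ∈ S ∧ j ∈ S
    · rw [hBD i h.1 j h.2, hDH i h.1 j h.2 ⟨hij, (hS i).1 h.1, (hS j).1 h.2⟩]
    -- An edge outside `S × S` is off-diagonal, because a loop would put its vertex in `S`.
    · refine hBH i j ?_ h
      rintro rfl
      exact h ⟨(hS i).2 hij, (hS i).2 hij⟩
  obtain ⟨P, hP, hPpos, hPA⟩ := hpart _ (rotatedIm_isHermitian _ _)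
    fun K hKS hKR => (hclique K hKS hKR).1
  obtain ⟨Q, hQ, hQpos, hQA⟩ := hpart _ (rotatedIm_isHermitian _ _)
    fun K hKS hKR => (hclique K hKS hKR).2
  have hD := exp_mul_star_exp_sub_ne_zero hpos hlt
  refine ⟨ofRotatedIm (Complex.exp (Complex.I * α)) (Complex.exp (Complex.I * β)) P Q,
    fun i j hij => ?_, ?_⟩
  -- The reconstruction is entrywise, so agreement of `P` and `Q` with the parts of `A` at an edge
  -- gives back the specified entry.
  · rw [← hA i j hij]
    conv_rhs => rw [← ofRotatedIm_rotatedIm (A := A) hD]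
    simp only [ofRotatedIm, Matrix.of_apply, hPA i j hij, hQA i j hij]
  · rw [mem_strictPhaseBoundedCone_iff_isPosDefOn hpos hlt, rotatedIm_ofRotatedIm_left hD hP hQ,
      rotatedIm_ofRotatedIm_right hD hP hQ]
    exact ⟨hPpos, hQpos⟩
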